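/- Let $n\ge 0$ be an integer, let $\alpha_0<\alpha_1<\cdots<\alpha_n$ be real numbers, and let $\sigma_0,\dots,\sigma_n\in\{1,-1\}$. Let $k$ be the number of variations of the sign sequence, i.e. the number of indices $i\in\{0,\dots,n-1\}$ with $\sigma_i=-\sigma_{i+1}$. Let $S$ be any finite multiset of positive real numbers, and let $p$ be its cardinality (elements counted with multiplicity). Then the following are equivalent: (a) there exist non-zero real numbers $a_0,\dots,a_n$, with $a_i$ of sign $\sigma_i$ for every $i$, such that $S$ is exactly the multiset of positive roots of the analytic function $$Y(x)=a_0x^{\alpha_0}+a_1x^{\alpha_1}+\cdots+a_nx^{\alpha_n}\qquad(x>0),$$ that is, for every $x>0$ the number of occurrences of $x$ in $S$ is the order of vanishing of $Y$ at $x$ (which is $0$ if $Y(x)\neq 0$); (b) $k-p$ is even and non-negative. -/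

import Mathlib

/-- The generalized polynomial `Y(x) = a₀ x^α₀ + a₁ x^α₁ + ⋯ + aₙ x^αₙ` with real exponents,
considered on the positive half-line. -/
noncomputable def generalizedPolynomial {n : ℕ} (α a : Fin (n + 1) → ℝ) (x : ℝ) : ℝ :=
  ∑ i, a i * x ^ α i

/-- The number of variations of a sequence of signs `σ₀, …, σₙ`: the number of indices `i < n`
with `σᵢ = -σᵢ₊₁`. (Used only for sequences of non-zero signs.) -/
def numVariations {n : ℕ} (σ : Fin (n + 1) → SignType) : ℕ :=
  (Finset.univ.filter fun i : Fin n => σ i.castSucc = -σ i.succ).card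

/-- `s` is the multiset of positive roots of `f`: `f` is analytic on the positive half-line, all
elements of `s` are positive, and every positive `x` occurs in `s` exactly as many times as its
order of vanishing as a zero of `f` (in particular zero times if `f x ≠ 0`). -/
def IsPositiveRootMultiset (f : ℝ → ℝ) (s : Multiset ℝ) : Prop :=
  AnalyticOnNhd ℝ f (Set.Ioi 0) ∧ (∀ x ∈ s, 0 < x) ∧
    ∀ x : ℝ, 0 < x → analyticOrderAt f x = (s.count x : ℕ∞)

open Set Filter Topology

/-! Necessity. Dividing `Y` by `x ^ γ` and differentiating multiplies each `a j` by `α j - γ`, up to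
a shift of exponents. With `γ` in a gap where the sign varies, this removes one variation, and by
Rolle it costs at most one root; hence `p ≤ k` (`card_le_card_of_separating`). For parity, write `Y`
as `rootPolynomial s` times a cofactor without positive zeros: its constant sign is read off from `a
n` at infinity and from `a 0` near zero.

Sufficiency. For each index `i`, choose `p + 1` indices including `i` along which `σ` alternates,
starting from `σ 0`. Linear algebra gives a non-trivial combination of these monomials vanishing on
`s`; the bound `p ≤ k` forces its coefficients to be non-zero and alternating, and excludes further
roots (`exists_alternating`). Summing over `i` makes every coefficient non-zero, and the cofactors
all have the same sign, so the sum has no extra root (`exists_realization`). The case `p = 0` is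
handled by hand. -/

/-! ### Factoring roots out of analytic functions. -/

theorem AnalyticAt.dslope {f : ℝ → ℝ} {t x : ℝ} (ht : AnalyticAt ℝ f t) (hx : AnalyticAt ℝ f x) :
    AnalyticAt ℝ (dslope f t) x := by
  by_cases h : x = t
  · subst h
    obtain ⟨p, hp⟩ := ht
    exact ⟨_, hp.has_fpower_series_dslope_fslope⟩
  · have h1 : AnalyticAt ℝ (fun y => (y - t)⁻¹ * (f y - f t)) x := by
      refine AnalyticAt.mul (AnalyticAt.inv (by fun_prop) (sub_ne_zero.2 h)) (by fun_prop)
    refine h1.congr ?_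
    filter_upwards [isOpen_ne.mem_nhds h] with y hy
    rw [dslope_of_ne _ hy, slope_def_field, div_eq_inv_mul]

/-- The order of vanishing of `(x - t) g`. -/
theorem analyticOrderAt_sub_mul {g : ℝ → ℝ} {x : ℝ} (t : ℝ) (hg : AnalyticAt ℝ g x) :
    analyticOrderAt (fun y => (y - t) * g y) x = (if x = t then 1 else 0) + analyticOrderAt g x := by
  have h := analyticOrderAt_mul (f := fun y : ℝ => y - t) (z₀ := x) (by fun_prop) hg
  have e : ((fun y : ℝ => y - t) * g) = fun y => (y - t) * g y := rfl
  rw [e] at h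
  rw [h]
  split_ifs with hx
  · subst hx; simp
  · simp [hx]

/-- The monic polynomial function with root multiset `s`. -/
noncomputable def rootPolynomial (s : Multiset ℝ) (x : ℝ) : ℝ := (s.map fun t => x - t).prod

theorem rootPolynomial_cons (t : ℝ) (s : Multiset ℝ) (x : ℝ) :
    rootPolynomial (t ::ₘ s) x = (x - t) * rootPolynomial s x := by simp [rootPolynomial]

theorem analyticAt_rootPolynomial (s : Multiset ℝ) (x : ℝ) :
    AnalyticAt ℝ (rootPolynomial s) x := by
  induction s using Multiset.induction_on with
  | empty => simpa [rootPolynomial, funext_iff] using! (analyticAt_const (v := (1 : ℝ)) (x := x))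
  | cons t s ih =>
    have : rootPolynomial (t ::ₘ s) = fun x => (x - t) * rootPolynomial s x :=
      funext (rootPolynomial_cons t s)
    rw [this]
    fun_prop

theorem analyticOrderAt_rootPolynomial_mul (s : Multiset ℝ) {g : ℝ → ℝ} {x : ℝ}
    (hg : AnalyticAt ℝ g x) :
    analyticOrderAt (fun y => rootPolynomial s y * g y) x = s.count x + analyticOrderAt g x := by
  induction s using Multiset.induction_on with
  | empty => simp [rootPolynomial]
  | cons t s ih =>
    have e : (fun y => rootPolynomial (t ::ₘ s) y * g y)
        = fun y => (y - t) * (rootPolynomial s y * g y) := by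
      funext y; rw [rootPolynomial_cons, mul_assoc]
    rw [e, analyticOrderAt_sub_mul, ih, Multiset.count_cons, ← add_assoc]
    · split_ifs <;> simp [add_comm]
    · exact (analyticAt_rootPolynomial s x).mul hg

/-- `f` vanishes at every positive `x` to at least the order prescribed by the multiset `s`. -/
def VanishesOn (f : ℝ → ℝ) (s : Multiset ℝ) : Prop :=
  ∀ x : ℝ, 0 < x → (s.count x : ℕ∞) ≤ analyticOrderAt f x

theorem VanishesOn.apply_eq_zero {f : ℝ → ℝ} {s : Multiset ℝ} (h : VanishesOn f s) {x : ℝ}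
    (hx : x ∈ s) (hx0 : 0 < x) : f x = 0 := by
  apply apply_eq_zero_of_analyticOrderAt_ne_zero (𝕜 := ℝ)
  intro h0
  have := h x hx0
  rw [h0] at this
  simp [hx] at this

/-- Roots are peeled off one at a time: `dslope f t` is the analytic quotient by `x - t`. -/
theorem VanishesOn.exists_eq_rootPolynomial_mul {s : Multiset ℝ} (hs : ∀ x ∈ s, 0 < x) :
    ∀ {f : ℝ → ℝ}, AnalyticOnNhd ℝ f (Ioi 0) → VanishesOn f s →
      ∃ g : ℝ → ℝ, AnalyticOnNhd ℝ g (Ioi 0) ∧ f = fun x => rootPolynomial s x * g x := by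
  induction s using Multiset.induction_on with
  | empty => intro f hf _; exact ⟨f, hf, by simp [rootPolynomial]⟩
  | cons t s ih =>
    intro f hf h
    have ht : 0 < t := hs t (by simp)
    have hft : f t = 0 := h.apply_eq_zero (by simp) ht
    have e : f = fun x => (x - t) * dslope f t x := by
      funext x
      have := sub_smul_dslope f t x
      rw [smul_eq_mul, hft, sub_zero] at this
      exact this.symm
    have hd : AnalyticOnNhd ℝ (dslope f t) (Ioi 0) := fun x hx => (hf t ht).dslope (hf x hx)
    obtain ⟨g, hg, hfg⟩ := ih (fun x hx => hs x (Multiset.mem_cons_of_mem hx)) hd (by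
      intro x hx
      have h1 := h x hx
      rw [e, analyticOrderAt_sub_mul t (hd x hx), Multiset.count_cons] at h1
      split_ifs at h1 with hxt
      · rw [add_comm, Nat.cast_add, Nat.cast_one] at h1
        exact (ENat.add_le_add_iff_left (by simp)).1 h1
      · simpa using h1)
    refine ⟨g, hg, ?_⟩
    rw [e, hfg]
    funext x
    rw [rootPolynomial_cons, mul_assoc]

/-! ### Rolle's theorem and Descartes' bound. -/

/-- **Rolle's theorem with multiplicities.** -/
theorem VanishesOn.exists_deriv {f : ℝ → ℝ} (hf : AnalyticOnNhd ℝ f (Ioi 0)) {s : Multiset ℝ}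
    (hs : ∀ x ∈ s, 0 < x) (h : VanishesOn f s) :
    ∃ s' : Multiset ℝ, (∀ x ∈ s', 0 < x) ∧ VanishesOn (deriv f) s' ∧ s.card ≤ s'.card + 1 := by
  classical
  have rolle : ∀ x y : ℝ, x ∈ s → y ∈ s → x < y → ∃ z, x < z ∧ z < y ∧ deriv f z = 0 := by
    intro x y hx hy hxy
    obtain ⟨z, hz, hz'⟩ := exists_deriv_eq_zero (f := f) hxy
      (fun w hw => (hf w ((hs x hx).trans_le hw.1)).continuousAt.continuousWithinAt)
      ((h.apply_eq_zero hx (hs x hx)).trans (h.apply_eq_zero hy (hs y hy)).symm)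
    exact ⟨z, hz.1, hz.2, hz'⟩
  choose! r hr1 hr2 hr3 using rolle
  set d := s.toFinset with hd
  set t : Finset ℝ := ((d ×ˢ d).filter fun q => q.1 < q.2).image fun q => r q.1 q.2 with ht
  have ht0 : ∀ z ∈ t, 0 < z ∧ deriv f z = 0 := by
    intro z hz
    simp only [ht, hd, Finset.mem_image, Finset.mem_filter, Finset.mem_product,
      Multiset.mem_toFinset, Prod.exists] at hz
    obtain ⟨x, y, ⟨⟨hx, hy⟩, hxy⟩, rfl⟩ := hz
    exact ⟨(hs x hx).trans (hr1 x y hx hy hxy), hr3 x y hx hy hxy⟩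
  have hcard : d.card ≤ (t \ d).card + 1 := by
    refine Finset.card_le_sdiff_of_interleaved ?_
    intro x hx y hy hxy _
    rw [hd, Multiset.mem_toFinset] at hx hy
    refine ⟨r x y, ?_, hr1 x y hx hy hxy, hr2 x y hx hy hxy⟩
    simp only [ht, hd, Finset.mem_image, Finset.mem_filter, Finset.mem_product,
      Multiset.mem_toFinset, Prod.exists]
    exact ⟨x, y, ⟨⟨hx, hy⟩, hxy⟩, rfl⟩
  have hle : d.val ≤ s := by rw [hd, Multiset.toFinset_val]; exact Multiset.dedup_le s
  -- Every distinct root loses one unit of multiplicity; the Rolle points outside `d` make up for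
  -- all but one of these losses.
  refine ⟨(s - d.val) + (t \ d).val, ?_, ?_, ?_⟩
  · intro x hx
    rcases Multiset.mem_add.1 hx with hx | hx
    · exact hs x (Multiset.mem_of_le (Multiset.sub_le_self _ _) hx)
    · exact (ht0 x (Finset.mem_sdiff.1 hx).1).1
  · intro x hx
    rw [Multiset.count_add, Multiset.count_sub]
    by_cases hxs : x ∈ s
    · have h1 : (t \ d).val.count x = 0 := by
        rw [Multiset.count_eq_zero, Finset.mem_val, Finset.mem_sdiff]
        exact fun hh => hh.2 (Multiset.mem_toFinset.2 hxs)
      have h2 : d.val.count x = 1 :=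
        Multiset.count_eq_one_of_mem d.nodup (Multiset.mem_toFinset.2 hxs)
      rw [h1, h2, add_zero, analyticOrderAt_deriv_ge_iff (hf x hx) (h.apply_eq_zero hxs hx),
        ← Nat.cast_add_one, Nat.sub_add_cancel (Multiset.one_le_count_iff_mem.2 hxs)]
      exact h x hx
    · rw [Multiset.count_eq_zero.2 hxs, Nat.zero_sub, zero_add]
      by_cases hxt : x ∈ t \ d
      · rw [Multiset.count_eq_one_of_mem (t \ d).nodup hxt, Nat.cast_one,
          Order.one_le_iff_ne_zero, (hf x hx).deriv.analyticOrderAt_ne_zero]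
        exact (ht0 x (Finset.mem_sdiff.1 hxt).1).2
      · rw [Multiset.count_eq_zero.2 hxt]; simp
  · rw [Multiset.card_add, Multiset.card_sub hle]
    have := Multiset.card_le_card hle
    simp only [Finset.card_val] at *
    omega

theorem VanishesOn.congr {f g : ℝ → ℝ} {s : Multiset ℝ} (h : VanishesOn f s)
    (hfg : EqOn f g (Ioi 0)) : VanishesOn g s := by
  intro x hx
  rw [← analyticOrderAt_congr (hfg.eventuallyEq_of_mem (isOpen_Ioi.mem_nhds hx))]
  exact h x hx

theorem Real.analyticAt_rpow_const {x : ℝ} (hx : 0 < x) (r : ℝ) :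
    AnalyticAt ℝ (fun y : ℝ => y ^ r) x :=
  (Real.contDiffAt_rpow_const_of_ne hx.ne').analyticAt

theorem analyticOnNhd_generalizedPolynomial {n : ℕ} (α a : Fin (n + 1) → ℝ) :
    AnalyticOnNhd ℝ (generalizedPolynomial α a) (Ioi 0) := by
  intro x hx
  unfold generalizedPolynomial
  refine Finset.analyticAt_fun_sum _ fun i _ => ?_
  exact analyticAt_const.mul (Real.analyticAt_rpow_const hx _)

theorem deriv_generalizedPolynomial {n : ℕ} (α a : Fin (n + 1) → ℝ) {x : ℝ} (hx : 0 < x) :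
    deriv (generalizedPolynomial α a) x
      = generalizedPolynomial (fun i => α i - 1) (fun i => a i * α i) x := by
  unfold generalizedPolynomial
  apply HasDerivAt.deriv
  refine HasDerivAt.fun_sum fun i _ => ?_
  rw [mul_assoc]
  exact (Real.hasDerivAt_rpow_const (Or.inl hx.ne')).const_mul _

theorem generalizedPolynomial_sub_const {n : ℕ} (α a : Fin (n + 1) → ℝ) (γ : ℝ) {x : ℝ}
    (hx : 0 < x) :
    generalizedPolynomial (fun i => α i - γ) a x = x ^ (-γ) * generalizedPolynomial α a x := by
  unfold generalizedPolynomial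
  rw [Finset.mul_sum]
  refine Finset.sum_congr rfl fun i _ => ?_
  change a i * x ^ (α i - γ) = _
  rw [sub_eq_add_neg, Real.rpow_add hx]
  ring

theorem VanishesOn.mul_left {f g : ℝ → ℝ} {s : Multiset ℝ} (h : VanishesOn f s)
    (hf : AnalyticOnNhd ℝ f (Ioi 0)) (hg : AnalyticOnNhd ℝ g (Ioi 0)) :
    VanishesOn (fun x => g x * f x) s := by
  intro x hx
  have := analyticOrderAt_mul (hg x hx) (hf x hx)
  exact (h x hx).trans (le_add_self.trans this.ge)

theorem VanishesOn.sub_const {n : ℕ} {α a : Fin (n + 1) → ℝ} {s : Multiset ℝ}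
    (h : VanishesOn (generalizedPolynomial α a) s) (γ : ℝ) :
    VanishesOn (generalizedPolynomial (fun i => α i - γ) a) s :=
  (h.mul_left (analyticOnNhd_generalizedPolynomial α a)
    (fun _ hx => Real.analyticAt_rpow_const hx (-γ))).congr
    fun _ hx => (generalizedPolynomial_sub_const α a γ hx).symm

/-- **Descartes' rule of signs**, in terms of points `Γ` separating the exponents. -/
theorem card_le_card_of_separating {n : ℕ} (Γ : Multiset ℝ) :
    ∀ {α a : Fin (n + 1) → ℝ} {s : Multiset ℝ},
      (∀ j, 0 < a j * (Γ.map fun γ => α j - γ).prod) → (∀ x ∈ s, 0 < x) →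
      VanishesOn (generalizedPolynomial α a) s → s.card ≤ Γ.card := by
  induction Γ using Multiset.induction_on with
  | empty =>
    intro α a s ha hs h
    simp only [Multiset.map_zero, Multiset.prod_zero, mul_one] at ha
    rw [Multiset.card_zero, Nat.le_zero, Multiset.card_eq_zero, Multiset.eq_zero_iff_forall_notMem]
    intro x hx
    refine (h.apply_eq_zero hx (hs x hx)).not_gt ?_
    exact Finset.sum_pos (fun i _ => mul_pos (ha i) (Real.rpow_pos_of_pos (hs x hx) _))
      Finset.univ_nonempty
  | cons γ Γ ih =>
    intro α a s ha hs h
    obtain ⟨s', hs', h', hc⟩ :=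
      (h.sub_const γ).exists_deriv (analyticOnNhd_generalizedPolynomial _ _) hs
    -- Multiplying by `x ^ (γ + 1)` restores the exponents `α`, now with coefficients `a j * (α j -
    -- γ)`.
    have h2 := (h'.congr fun x hx => deriv_generalizedPolynomial _ _ hx).sub_const (-(γ + 1))
    have e : (fun i => α i - γ - 1 - -(γ + 1)) = α := by funext i; ring
    rw [e] at h2
    have := ih (fun j => by simpa [mul_assoc] using ha j) hs' h2
    rw [Multiset.card_cons]
    omega

/-- The midpoints of the gaps at which the sign varies separate the coefficients by sign. -/
theorem exists_separating {n : ℕ} {α a : Fin (n + 1) → ℝ} (hα : StrictMono α) (ha : ∀ i, a i ≠ 0) :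
    ∃ Γ : Multiset ℝ, Γ.card = numVariations (fun i => SignType.sign (a i)) ∧
      ((∀ j, 0 < a j * (Γ.map fun γ => α j - γ).prod) ∨
        ∀ j, 0 < -a j * (Γ.map fun γ => α j - γ).prod) := by
  set V : Finset (Fin n) := Finset.univ.filter fun i : Fin n =>
    SignType.sign (a i.castSucc) = -SignType.sign (a i.succ) with hV
  set γ : Fin n → ℝ := fun i => (α i.castSucc + α i.succ) / 2 with hγ
  have hγ1 : ∀ i, α i.castSucc < γ i ∧ γ i < α i.succ := by
    intro i
    have := hα (Fin.castSucc_lt_succ (i := i))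
    constructor <;> simp only [hγ] <;> linarith
  set w : Fin (n + 1) → ℝ := fun j => ∏ i ∈ V, (α j - γ i) with hw
  have hprod : ∀ j, (((V.val.map γ).map fun g => α j - g).prod) = w j := by
    intro j; rw [Multiset.map_map]; rfl
  -- The midpoint of a gap separates no other pair of consecutive exponents, so `w` changes sign
  -- exactly where `a` does.
  have hsame : ∀ i j : Fin n, i ≠ j → 0 < (α j.castSucc - γ i) * (α j.succ - γ i) := by
    intro i j hij
    rcases lt_or_gt_of_ne hij with h | h
    · have h1 : α i.succ ≤ α j.castSucc := hα.monotone (by rw [Fin.le_def]; simpa using h)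
      have h2 := (hα.monotone (Fin.castSucc_lt_succ (i := j)).le)
      have := (hγ1 i).2
      exact mul_pos (by linarith) (by linarith)
    · have h1 : α j.succ ≤ α i.castSucc := hα.monotone (by rw [Fin.le_def]; simpa using h)
      have h2 := (hα.monotone (Fin.castSucc_lt_succ (i := j)).le)
      have := (hγ1 i).1
      exact mul_pos_of_neg_of_neg (by linarith) (by linarith)
  have hww : ∀ j : Fin n, 0 < (a j.castSucc * w j.castSucc) * (a j.succ * w j.succ) := by
    intro j
    have e : (a j.castSucc * w j.castSucc) * (a j.succ * w j.succ)
        = (a j.castSucc * a j.succ) * ∏ i ∈ V, ((α j.castSucc - γ i) * (α j.succ - γ i)) := by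
      rw [Finset.prod_mul_distrib]; ring
    rw [e]
    have h0 := ha j.castSucc
    have h1 := ha j.succ
    by_cases hj : j ∈ V
    · rw [← Finset.mul_prod_erase _ _ hj]
      have hp : 0 < ∏ i ∈ V.erase j, ((α j.castSucc - γ i) * (α j.succ - γ i)) :=
        Finset.prod_pos fun i hi => hsame i j (Finset.ne_of_mem_erase hi)
      have hn : (α j.castSucc - γ j) * (α j.succ - γ j) < 0 :=
        mul_neg_of_neg_of_pos (by linarith [(hγ1 j).1]) (by linarith [(hγ1 j).2])
      have hs : a j.castSucc * a j.succ < 0 := by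
        rw [hV, Finset.mem_filter] at hj
        rcases h0.lt_or_gt with h | h <;> rcases h1.lt_or_gt with h' | h' <;>
          simp [h, h'] at hj <;> nlinarith
      exact mul_pos_of_neg_of_neg hs (mul_neg_of_neg_of_pos hn hp)
    · have hs : 0 < a j.castSucc * a j.succ := by
        have hj' : ¬ SignType.sign (a j.castSucc) = -SignType.sign (a j.succ) := by
          simpa [hV] using hj
        rcases h0.lt_or_gt with h | h <;> rcases h1.lt_or_gt with h' | h' <;>
          simp [h, h'] at hj' <;> nlinarith
      refine mul_pos hs (Finset.prod_pos fun i hi => hsame i j ?_)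
      rintro rfl; exact hj hi
  -- For `n = 0` there is no gap, so `hww` says nothing.
  have hwz : a 0 * w 0 ≠ 0 := by
    rcases n with _ | n
    · exact mul_ne_zero (ha 0) (Finset.prod_ne_zero_iff.2 fun i => i.elim0)
    · exact left_ne_zero_of_mul (hww 0).ne'
  have key : ∀ j, 0 < (a 0 * w 0) * (a j * w j) := by
    intro j
    induction j using Fin.induction with
    | zero => exact mul_self_pos.2 hwz
    | succ i ih =>
      have := mul_pos ih (hww i)
      have h2 : 0 < (a i.castSucc * w i.castSucc) ^ 2 :=
        sq_pos_of_ne_zero (right_ne_zero_of_mul ih.ne')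
      by_contra hc
      nlinarith [mul_nonneg_of_nonpos_of_nonpos (not_lt.1 hc) (neg_nonpos.2 h2.le)]
  refine ⟨V.val.map γ, by rw [Multiset.card_map]; rfl, ?_⟩
  simp only [hprod]
  rcases hwz.lt_or_gt with h | h
  · right
    intro j
    have := key j
    by_contra hc
    nlinarith
  · left
    intro j
    exact (mul_pos_iff_of_pos_left h).1 (key j)

theorem generalizedPolynomial_neg {n : ℕ} (α a : Fin (n + 1) → ℝ) :
    generalizedPolynomial α (fun i => -a i) = -generalizedPolynomial α a := by
  funext x
  simp [generalizedPolynomial]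

/-- **Descartes' rule of signs** for real exponents and non-zero coefficients. -/
theorem VanishesOn.card_le_numVariations {n : ℕ} {α a : Fin (n + 1) → ℝ} (hα : StrictMono α)
    (ha : ∀ i, a i ≠ 0) {s : Multiset ℝ} (hs : ∀ x ∈ s, 0 < x)
    (h : VanishesOn (generalizedPolynomial α a) s) :
    s.card ≤ numVariations (fun i => SignType.sign (a i)) := by
  obtain ⟨Γ, hΓ, h1 | h1⟩ := exists_separating hα ha
  · exact (card_le_card_of_separating Γ h1 hs h).trans hΓ.le
  · refine (card_le_card_of_separating Γ h1 hs fun x hx => ?_).trans hΓ.le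
    rw [generalizedPolynomial_neg, analyticOrderAt_neg]
    exact h x hx

/-! ### Signs near zero and at infinity. -/

theorem rootPolynomial_eventually_pos (s : Multiset ℝ) :
    ∀ᶠ x in atTop, 0 < rootPolynomial s x := by
  induction s using Multiset.induction_on with
  | empty => simp [rootPolynomial]
  | cons t s ih =>
    filter_upwards [ih, eventually_gt_atTop t] with x h1 h2
    rw [rootPolynomial_cons]
    exact mul_pos (sub_pos.2 h2) h1

theorem rootPolynomial_eventually_pos_zero {s : Multiset ℝ} (hs : ∀ x ∈ s, 0 < x) :
    ∀ᶠ x in 𝓝[>] (0 : ℝ), 0 < (-1) ^ s.card * rootPolynomial s x := by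
  induction s using Multiset.induction_on with
  | empty => simp [rootPolynomial]
  | cons t s ih =>
    filter_upwards [ih fun x hx => hs x (Multiset.mem_cons_of_mem hx),
      mem_nhdsWithin_of_mem_nhds (Iio_mem_nhds (hs t (by simp)))] with x h1 h2
    rw [rootPolynomial_cons, Multiset.card_cons]
    have := mul_pos (sub_pos.2 h2) h1
    rw [pow_succ]
    linarith

/-- Common to both ends: the dominant index `j` is the last one at infinity and `0` near zero. -/
theorem tendsto_generalizedPolynomial {n : ℕ} {α a : Fin (n + 1) → ℝ} {l : Filter ℝ}
    (j : Fin (n + 1)) (hl : ∀ᶠ x in l, 0 < x)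
    (h : ∀ i, i ≠ j → Tendsto (fun x : ℝ => x ^ (α i - α j)) l (𝓝 0)) :
    Tendsto (fun x => x ^ (-α j) * generalizedPolynomial α a x) l (𝓝 (a j)) := by
  have : Tendsto (generalizedPolynomial (fun i => α i - α j) a) l
      (𝓝 (∑ i, if i = j then a j else 0)) := by
    refine tendsto_finsetSum _ fun i _ => ?_
    split_ifs with hij
    · subst hij; simpa using tendsto_const_nhds
    · simpa using (h i hij).const_mul (a i)
  rw [Finset.sum_ite_eq' Finset.univ j, if_pos (Finset.mem_univ j)] at this
  refine this.congr' ?_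
  filter_upwards [hl] with x hx using generalizedPolynomial_sub_const α a (α j) hx

theorem eventually_pos_of_tendsto {n : ℕ} {α a : Fin (n + 1) → ℝ} {l : Filter ℝ}
    {j : Fin (n + 1)} (hj : a j ≠ 0) (hl : ∀ᶠ x in l, 0 < x)
    (h : Tendsto (fun x => x ^ (-α j) * generalizedPolynomial α a x) l (𝓝 (a j))) :
    ∀ᶠ x in l, 0 < a j * generalizedPolynomial α a x := by
  have h1 := h.const_mul (a j)
  filter_upwards [h1.eventually (lt_mem_nhds (mul_self_pos.2 hj)), hl] with x hx hx0
  rw [mul_left_comm] at hx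
  exact (mul_pos_iff_of_pos_left (Real.rpow_pos_of_pos hx0 _)).1 hx

theorem generalizedPolynomial_eventually_atTop {n : ℕ} {α a : Fin (n + 1) → ℝ}
    (hα : StrictMono α) (ha : a (Fin.last n) ≠ 0) :
    ∀ᶠ x in atTop, 0 < a (Fin.last n) * generalizedPolynomial α a x := by
  refine eventually_pos_of_tendsto ha (eventually_gt_atTop 0)
    (tendsto_generalizedPolynomial _ (eventually_gt_atTop 0) fun i hi => ?_)
  have : 0 < α (Fin.last n) - α i := sub_pos.2 (hα (Fin.lt_last_iff_ne_last.2 hi))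
  simpa using tendsto_rpow_neg_atTop this

theorem generalizedPolynomial_eventually_zero {n : ℕ} {α a : Fin (n + 1) → ℝ}
    (hα : StrictMono α) (ha : a 0 ≠ 0) :
    ∀ᶠ x in 𝓝[>] (0 : ℝ), 0 < a 0 * generalizedPolynomial α a x := by
  refine eventually_pos_of_tendsto ha self_mem_nhdsWithin
    (tendsto_generalizedPolynomial _ self_mem_nhdsWithin fun i hi => ?_)
  have h : 0 < α i - α 0 := sub_pos.2 (hα (Fin.pos_iff_ne_zero.2 hi))
  have := (Real.continuousAt_rpow_const (0 : ℝ) (α i - α 0) (Or.inr h.le)).tendsto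
  rw [Real.zero_rpow h.ne'] at this
  exact this.mono_left nhdsWithin_le_nhds

theorem mul_pos_of_continuousOn_of_ne_zero {g : ℝ → ℝ} {U : Set ℝ} (hU : IsPreconnected U)
    (hg : ContinuousOn g U) (h0 : ∀ x ∈ U, g x ≠ 0) {x y : ℝ} (hx : x ∈ U) (hy : y ∈ U) :
    0 < g x * g y := by
  by_contra hc
  have key : ∀ x ∈ U, ∀ y ∈ U, g x < 0 → 0 < g y → False := by
    intro x hx y hy h1 h2
    obtain ⟨z, hz, hz0⟩ := hU.intermediate_value hx hy hg ⟨h1.le, h2.le⟩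
    exact h0 z hz hz0
  rcases (h0 x hx).lt_or_gt with h1 | h1 <;> rcases (h0 y hy).lt_or_gt with h2 | h2
  · exact hc (mul_pos_of_neg_of_neg h1 h2)
  · exact key x hx y hy h1 h2
  · exact key y hy x hx h2 h1
  · exact hc (mul_pos h1 h2)

/-- The sign of the cofactor of the root polynomial is that of the leading coefficient. -/
theorem pos_mul_cofactor {n : ℕ} {α a : Fin (n + 1) → ℝ} (hα : StrictMono α) {s : Multiset ℝ}
    {g : ℝ → ℝ} (hg : AnalyticOnNhd ℝ g (Ioi 0)) (hg0 : ∀ x, 0 < x → g x ≠ 0)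
    (hfg : generalizedPolynomial α a = fun x => rootPolynomial s x * g x)
    (ha : a (Fin.last n) ≠ 0) {x : ℝ} (hx : 0 < x) : 0 < a (Fin.last n) * g x := by
  obtain ⟨y, h1, h2, h3⟩ := ((generalizedPolynomial_eventually_atTop hα ha).and
    ((rootPolynomial_eventually_pos s).and (eventually_gt_atTop 0))).exists
  have h4 := mul_pos_of_continuousOn_of_ne_zero isPreconnected_Ioi hg.continuousOn
    (fun x hx => hg0 x hx) (mem_Ioi.2 hx) (mem_Ioi.2 h3)
  rw [hfg, mul_left_comm] at h1
  have h5 := (mul_pos_iff_of_pos_left h2).1 h1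
  have h6 := mul_pos h4 h5
  have h7 : 0 < g y ^ 2 := sq_pos_of_ne_zero (hg0 y h3)
  by_contra hc
  nlinarith

/-- The sign of the cofactor of the root polynomial, in terms of the lowest coefficient. -/
theorem pos_mul_cofactor_zero {n : ℕ} {α a : Fin (n + 1) → ℝ} (hα : StrictMono α) {s : Multiset ℝ}
    (hs : ∀ x ∈ s, 0 < x)
    {g : ℝ → ℝ} (hg : AnalyticOnNhd ℝ g (Ioi 0)) (hg0 : ∀ x, 0 < x → g x ≠ 0)
    (hfg : generalizedPolynomial α a = fun x => rootPolynomial s x * g x)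
    (ha : a 0 ≠ 0) {x : ℝ} (hx : 0 < x) : 0 < (-1) ^ s.card * a 0 * g x := by
  obtain ⟨y, h1, h2, h3⟩ := ((generalizedPolynomial_eventually_zero hα ha).and
    ((rootPolynomial_eventually_pos_zero hs).and self_mem_nhdsWithin)).exists
  have h4 := mul_pos_of_continuousOn_of_ne_zero isPreconnected_Ioi hg.continuousOn
    (fun x hx => hg0 x hx) (mem_Ioi.2 hx) h3
  rw [hfg] at h1
  have h8 : ((-1 : ℝ) ^ s.card) * (-1) ^ s.card = 1 := by
    rw [← mul_pow]; norm_num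
  have h1' : 0 < ((-1) ^ s.card * rootPolynomial s y) * ((-1) ^ s.card * a 0 * g y) := by
    calc 0 < a 0 * (rootPolynomial s y * g y) := h1
      _ = (((-1 : ℝ) ^ s.card) * (-1) ^ s.card) * (a 0 * (rootPolynomial s y * g y)) := by
        rw [h8, one_mul]
      _ = _ := by ring
  have h5 := (mul_pos_iff_of_pos_left h2).1 h1'
  have h6 := mul_pos h4 h5
  have h7 : 0 < g y ^ 2 := sq_pos_of_ne_zero (hg0 y h3)
  by_contra hc
  nlinarith

/-! ### Variations counted up to an index. -/

/-- The number of variations of `σ` strictly before the index `j`. -/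
def numVariationsBefore {n : ℕ} (σ : Fin (n + 1) → SignType) (j : Fin (n + 1)) : ℕ :=
  (Finset.univ.filter fun i : Fin n => i.castSucc < j ∧ σ i.castSucc = -σ i.succ).card

theorem numVariationsBefore_zero {n : ℕ} (σ : Fin (n + 1) → SignType) :
    numVariationsBefore σ 0 = 0 := by
  simp [numVariationsBefore]

theorem numVariationsBefore_last {n : ℕ} (σ : Fin (n + 1) → SignType) :
    numVariationsBefore σ (Fin.last n) = numVariations σ := by
  simp [numVariationsBefore, numVariations, Fin.castSucc_lt_last]

theorem numVariationsBefore_succ {n : ℕ} (σ : Fin (n + 1) → SignType) (i : Fin n) :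
    numVariationsBefore σ i.succ =
      numVariationsBefore σ i.castSucc + if σ i.castSucc = -σ i.succ then 1 else 0 := by
  unfold numVariationsBefore
  split_ifs with h
  · rw [← Finset.card_insert_of_notMem (a := i) (by simp)]
    congr 1
    ext k
    simp only [Finset.mem_filter, Finset.mem_univ, true_and, Finset.mem_insert, Fin.lt_def,
      Fin.val_castSucc, Fin.val_succ, Fin.ext_iff]
    constructor
    · rintro ⟨h1, h2⟩
      by_cases hk : (k : ℕ) = i
      · exact Or.inl hk
      · exact Or.inr ⟨by omega, h2⟩
    · rintro (h1 | ⟨h1, h2⟩)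
      · obtain rfl := Fin.ext h1
        exact ⟨by omega, h⟩
      · exact ⟨by omega, h2⟩
  · rw [add_zero]
    congr 1
    ext k
    simp only [Finset.mem_filter, Finset.mem_univ, true_and, Fin.lt_def,
      Fin.val_castSucc, Fin.val_succ]
    constructor
    · rintro ⟨h1, h2⟩
      refine ⟨?_, h2⟩
      by_contra hk
      obtain rfl : k = i := Fin.ext (by omega)
      exact h h2
    · rintro ⟨h1, h2⟩
      exact ⟨by omega, h2⟩

theorem numVariationsBefore_monotone {n : ℕ} (σ : Fin (n + 1) → SignType) :
    Monotone (numVariationsBefore σ) := by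
  intro i j hij
  refine Finset.card_le_card fun k hk => ?_
  simp only [Finset.mem_filter, Finset.mem_univ, true_and] at hk ⊢
  exact ⟨hk.1.trans_le hij, hk.2⟩

/-- A discrete intermediate value theorem: the count starts at `0` and grows by at most one per
index. -/
theorem exists_numVariationsBefore_eq {n : ℕ} (σ : Fin (n + 1) → SignType) {m : ℕ}
    (hm : m ≤ numVariations σ) : ∃ j, numVariationsBefore σ j = m := by
  rw [← numVariationsBefore_last] at hm
  generalize Fin.last n = j at hm
  induction j using Fin.induction with
  | zero => exact ⟨0, by rw [numVariationsBefore_zero] at hm ⊢; omega⟩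
  | succ i ih =>
    by_cases h : m ≤ numVariationsBefore σ i.castSucc
    · exact ih h
    · refine ⟨i.succ, ?_⟩
      rw [numVariationsBefore_succ] at hm ⊢
      split_ifs at hm ⊢ <;> omega

theorem sign_eq_pow_numVariationsBefore {n : ℕ} {σ : Fin (n + 1) → SignType}
    (hσ : ∀ i, σ i ≠ 0) (j : Fin (n + 1)) : σ j = (-1) ^ numVariationsBefore σ j * σ 0 := by
  induction j using Fin.induction with
  | zero => simp [numVariationsBefore_zero]
  | succ i ih =>
    rw [numVariationsBefore_succ]
    split_ifs with h
    · rw [pow_succ, mul_neg_one, neg_mul, ← ih, h, neg_neg]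
    · rw [add_zero, ← ih]
      have h1 := hσ i.castSucc
      have h2 := hσ i.succ
      revert h h1 h2
      generalize σ i.castSucc = u
      generalize σ i.succ = v
      revert u v
      decide

/-! ### Cofactors without zeros, and parity. -/

theorem IsPositiveRootMultiset.vanishesOn {f : ℝ → ℝ} {s : Multiset ℝ}
    (h : IsPositiveRootMultiset f s) : VanishesOn f s := fun x hx => (h.2.2 x hx).ge

theorem IsPositiveRootMultiset.exists_cofactor {f : ℝ → ℝ} {s : Multiset ℝ}
    (h : IsPositiveRootMultiset f s) :
    ∃ g : ℝ → ℝ, AnalyticOnNhd ℝ g (Ioi 0) ∧ (∀ x, 0 < x → g x ≠ 0) ∧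
      f = fun x => rootPolynomial s x * g x := by
  obtain ⟨g, hg, hfg⟩ := h.vanishesOn.exists_eq_rootPolynomial_mul h.2.1 h.1
  refine ⟨g, hg, fun x hx => ?_, hfg⟩
  have h1 := h.2.2 x hx
  rw [hfg, analyticOrderAt_rootPolynomial_mul s (hg x hx)] at h1
  rw [← (hg x hx).analyticOrderAt_eq_zero]
  have h2 : (s.count x : ℕ∞) + analyticOrderAt g x = s.count x + 0 := by rw [h1, add_zero]
  exact ENat.add_right_injective_of_ne_top (by simp) h2

theorem isPositiveRootMultiset_of_cofactor {f g : ℝ → ℝ} {s : Multiset ℝ}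
    (hs : ∀ x ∈ s, 0 < x) (hg : AnalyticOnNhd ℝ g (Ioi 0)) (hg0 : ∀ x, 0 < x → g x ≠ 0)
    (hfg : f = fun x => rootPolynomial s x * g x) : IsPositiveRootMultiset f s := by
  subst hfg
  refine ⟨fun x hx => (analyticAt_rootPolynomial s x).mul (hg x hx), hs, fun x hx => ?_⟩
  rw [analyticOrderAt_rootPolynomial_mul s (hg x hx),
    (hg x hx).analyticOrderAt_eq_zero.2 (hg0 x hx), add_zero]

/-- The parity part of Descartes' rule of signs. -/
theorem IsPositiveRootMultiset.even_numVariations_add_card {n : ℕ} {α a : Fin (n + 1) → ℝ}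
    (hα : StrictMono α) (ha : ∀ i, a i ≠ 0) {s : Multiset ℝ}
    (h : IsPositiveRootMultiset (generalizedPolynomial α a) s) :
    Even (numVariations (fun i => SignType.sign (a i)) + s.card) := by
  obtain ⟨g, hg, hg0, hfg⟩ := h.exists_cofactor
  -- The point `1` is arbitrary: the cofactor has constant sign.
  have h1 := pos_mul_cofactor hα hg hg0 hfg (ha _) one_pos
  have h2 := pos_mul_cofactor_zero hα h.2.1 hg hg0 hfg (ha _) one_pos
  have h3 := sign_eq_pow_numVariationsBefore (σ := fun i => SignType.sign (a i))
    (fun i => sign_ne_zero.2 (ha i)) (Fin.last n)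
  rw [numVariationsBefore_last] at h3
  have h4 : (0 : ℝ) < (-1) ^ s.card * (a 0 * a (Fin.last n)) := by
    have h5 := mul_pos h1 h2
    have h6 : 0 < g 1 ^ 2 := sq_pos_of_ne_zero (hg0 1 one_pos)
    refine (mul_pos_iff_of_pos_left h6).1 ?_
    linarith
  have h5 : SignType.sign ((-1 : ℝ) ^ s.card * (a 0 * a (Fin.last n))) = 1 := sign_pos h4
  rw [sign_mul, sign_mul, h3, sign_pow, Left.sign_neg, sign_one] at h5
  have h6 : SignType.sign (a 0) * SignType.sign (a 0) = 1 := by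
    rw [← sign_mul]; exact sign_pos (mul_self_pos.2 (ha 0))
  rw [mul_left_comm (SignType.sign (a 0)), h6, mul_one, ← pow_add, add_comm] at h5
  by_contra hodd
  rw [(Nat.not_even_iff_odd.1 hodd).neg_one_pow] at h5
  exact absurd h5 (by decide)

/-! ### Interpolation with prescribed roots. -/

/-- There are `p` linear conditions on `p + 1` coefficients: the `i`-th copy of `x` in `s.ToType`,
counted from `0`, asks that the `i`-th derivative vanish at `x`. -/
theorem exists_vanishesOn {p : ℕ} (β : Fin (p + 1) → ℝ) {s : Multiset ℝ} (hsp : s.card = p) :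
    ∃ c : Fin (p + 1) → ℝ, c ≠ 0 ∧ VanishesOn (generalizedPolynomial β c) s := by
  set M : Matrix s.ToType (Fin (p + 1)) ℝ :=
    Matrix.of fun i j => iteratedDeriv i.2 (fun x : ℝ => x ^ β j) i.1
  have hker : LinearMap.ker M.mulVecLin ≠ ⊥ := by
    apply LinearMap.ker_ne_bot_of_finrank_lt
    simp [Multiset.card_coe, hsp]
  obtain ⟨c, hc, hc0⟩ := Submodule.exists_mem_ne_zero_of_ne_bot hker
  refine ⟨c, hc0, fun x hx => ?_⟩
  rw [natCast_le_analyticOrderAt_iff_iteratedDeriv_eq_zero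
    (analyticOnNhd_generalizedPolynomial β c x hx)]
  intro i hi
  have h1 := congrFun (LinearMap.mem_ker.1 hc) (⟨x, ⟨i, hi⟩⟩ : s.ToType)
  replace h1 : ∑ j, iteratedDeriv i (fun y : ℝ => y ^ β j) x * c j = 0 := h1
  have h2 : iteratedDeriv i (generalizedPolynomial β c) x
      = ∑ j, iteratedDeriv i (fun y : ℝ => c j * y ^ β j) x :=
    iteratedDeriv_fun_sum fun j _ =>
      (contDiffAt_const.mul (Real.contDiffAt_rpow_const_of_ne hx.ne'))
  rw [h2, ← h1]
  refine Finset.sum_congr rfl fun j _ => ?_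
  rw [iteratedDeriv_const_mul_field, mul_comm]

theorem generalizedPolynomial_comp {m n : ℕ} {e : Fin (m + 1) → Fin (n + 1)}
    (he : Function.Injective e) (α c : Fin (n + 1) → ℝ) (hc : ∀ i ∉ range e, c i = 0) :
    generalizedPolynomial (α ∘ e) (c ∘ e) = generalizedPolynomial α c := by
  funext x
  exact Fintype.sum_of_injective e he _ _ (fun i hi => by simp [hc i hi]) fun i => rfl

theorem numVariations_le {n : ℕ} (σ : Fin (n + 1) → SignType) : numVariations σ ≤ n :=
  (Finset.card_le_univ _).trans (Fintype.card_fin n).le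

/-- Monomials with real exponents form a Chebyshev system: a non-trivial combination of `p + 1` of
them with `p` positive roots has no zero coefficient. -/
theorem VanishesOn.coeff_ne_zero {p : ℕ} {β c : Fin (p + 1) → ℝ} (hβ : StrictMono β)
    {s : Multiset ℝ} (hs : ∀ x ∈ s, 0 < x) (hsp : s.card = p) (hc : c ≠ 0)
    (h : VanishesOn (generalizedPolynomial β c) s) (j : Fin (p + 1)) : c j ≠ 0 := by
  classical
  set S : Finset (Fin (p + 1)) := Finset.univ.filter fun i => c i ≠ 0 with hS
  have hne : S.Nonempty := by
    obtain ⟨i, hi⟩ := Function.ne_iff.1 hc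
    exact ⟨i, by simpa [hS] using hi⟩
  obtain ⟨m, hm⟩ := Nat.exists_eq_succ_of_ne_zero hne.card_pos.ne'
  set e := S.orderEmbOfFin hm with he
  have hrange : ∀ i, i ∈ range e ↔ c i ≠ 0 := by
    intro i
    rw [he, Finset.range_orderEmbOfFin]
    simp [hS]
  rw [← generalizedPolynomial_comp e.injective β c
    fun i hi => by rw [hrange] at hi; exact not_not.1 hi] at h
  -- On a support of size `m + 1` the bound gives `p ≤ m`, so the support is everything.
  have h1 := h.card_le_numVariations (hβ.comp e.strictMono)
    (fun i => (hrange _).1 (mem_range_self i)) hs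
  have h2 := h1.trans (numVariations_le _)
  have h3 : S = Finset.univ := by
    apply Finset.eq_univ_of_card
    have := Finset.card_le_univ S
    rw [Fintype.card_fin] at this ⊢
    omega
  have : j ∈ S := by rw [h3]; exact Finset.mem_univ j
  simpa [hS] using this

/-- Given `p` positive roots and `p + 1` exponents, there is a combination with exactly these
roots; its coefficients alternate in sign. -/
theorem exists_alternating {p : ℕ} {β : Fin (p + 1) → ℝ} (hβ : StrictMono β)
    {s : Multiset ℝ} (hs : ∀ x ∈ s, 0 < x) (hsp : s.card = p) {τ : SignType} (hτ : τ ≠ 0) :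
    ∃ c : Fin (p + 1) → ℝ, (∀ j, SignType.sign (c j) = (-1) ^ (j : ℕ) * τ) ∧
      IsPositiveRootMultiset (generalizedPolynomial β c) s := by
  obtain ⟨c, hc0, hv⟩ := exists_vanishesOn β hsp
  have hc := hv.coeff_ne_zero hβ hs hsp hc0
  have hroots : IsPositiveRootMultiset (generalizedPolynomial β c) s := by
    have han := analyticOnNhd_generalizedPolynomial β c
    obtain ⟨g, hg, hfg⟩ := hv.exists_eq_rootPolynomial_mul hs han
    refine isPositiveRootMultiset_of_cofactor hs hg (fun x hx hgx => ?_) hfg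
    -- A zero of the cofactor would be root number `p + 1`, but `p + 1` coefficients have at most
    -- `p` variations.
    have hv' : VanishesOn (generalizedPolynomial β c) (x ::ₘ s) := by
      intro y hy
      rw [hfg, analyticOrderAt_rootPolynomial_mul s (hg y hy), Multiset.count_cons, Nat.cast_add]
      gcongr
      split_ifs with hxy
      · subst hxy
        rw [Nat.cast_one, Order.one_le_iff_ne_zero, (hg y hy).analyticOrderAt_ne_zero]
        exact hgx
      · simp
    have h1 := hv'.card_le_numVariations hβ hc (by simpa [hx] using hs)
    have h2 := h1.trans (numVariations_le _)
    rw [Multiset.card_cons] at h2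
    omega
  -- Descartes' bound is attained, so the sign varies at every gap.
  have hvar : ∀ i : Fin p, SignType.sign (c i.castSucc) = -SignType.sign (c i.succ) := by
    have h1 := hv.card_le_numVariations hβ hc hs
    have h2 := Finset.eq_univ_of_card (Finset.univ.filter fun i : Fin p =>
      SignType.sign (c i.castSucc) = -SignType.sign (c i.succ)) (by
        refine le_antisymm (Finset.card_le_univ _) ?_
        rw [Fintype.card_fin]
        exact hsp.ge.trans h1)
    intro i
    have := Finset.mem_univ i
    rw [← h2] at this
    exact (Finset.mem_filter.1 this).2
  have halt : ∀ j, SignType.sign (c j) = (-1) ^ (j : ℕ) * SignType.sign (c 0) := by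
    intro j
    induction j using Fin.induction with
    | zero => simp
    | succ i ih =>
      rw [hvar i] at ih
      rw [← neg_neg (SignType.sign _), ih, Fin.val_succ, Fin.val_castSucc, pow_succ]
      simp
  have hτ' : SignType.sign (c 0) = τ ∨ SignType.sign (c 0) = -τ := by
    have := sign_ne_zero.2 (hc 0)
    revert this hτ
    generalize SignType.sign (c 0) = u
    revert u τ
    decide
  rcases hτ' with h0 | h0
  · exact ⟨c, fun j => by rw [halt, h0], hroots⟩
  · refine ⟨fun j => -c j, fun j => by rw [Left.sign_neg, halt, h0]; simp, ?_⟩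
    rw [generalizedPolynomial_neg]
    refine ⟨hroots.1.neg, hs, fun x hx => ?_⟩
    rw [analyticOrderAt_neg]
    exact hroots.2.2 x hx

/-! ### Partial realizations and their sum. -/

theorem sign_sum_eq {ι : Type*} {t : Finset ι} {u : ι → ℝ} {τ : SignType}
    (h : ∀ i ∈ t, u i = 0 ∨ SignType.sign (u i) = τ) (h0 : ∃ i ∈ t, u i ≠ 0) :
    SignType.sign (∑ i ∈ t, u i) = τ := by
  obtain ⟨i, hi, hi0⟩ := h0
  have hτ : SignType.sign (u i) = τ := (h i hi).resolve_left hi0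
  cases τ with
  | zero => exact absurd (sign_eq_zero_iff.1 hτ) hi0
  | pos =>
    refine sign_pos (Finset.sum_pos' (fun j hj => ?_) ⟨i, hi, sign_eq_one_iff.1 hτ⟩)
    rcases h j hj with h | h
    · exact h.ge
    · exact (sign_eq_one_iff.1 h).le
  | neg =>
    refine sign_neg (Finset.sum_neg' (fun j hj => ?_) ⟨i, hi, sign_eq_neg_one_iff.1 hτ⟩)
    rcases h j hj with h | h
    · exact h.le
    · exact (sign_eq_neg_one_iff.1 h).le

/-- If the number of variations of `σ` exceeds the positive number `p` by an even number, then every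
index lies in a subsequence of length `p + 1` along which `σ` alternates, starting from `σ 0`. -/
theorem exists_alternating_subsequence {n p : ℕ} {σ : Fin (n + 1) → SignType}
    (hσ : ∀ i, σ i ≠ 0) (hp : 0 < p) (hpk : p ≤ numVariations σ)
    (hpar : Even (numVariations σ + p)) (i : Fin (n + 1)) :
    ∃ e : Fin (p + 1) → Fin (n + 1), StrictMono e ∧ i ∈ range e ∧
      ∀ j, σ (e j) = (-1) ^ (j : ℕ) * σ 0 := by
  set b := numVariationsBefore σ with hb
  have hbk : b i ≤ numVariations σ := by
    rw [← numVariationsBefore_last]; exact numVariationsBefore_monotone σ (Fin.le_last i)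
  -- `q` is the position of `i` in the subsequence. If `b i > p` has the wrong parity for `q = p`,
  -- then `b i < numVariations σ`, which leaves a variation for one more term after `i`.
  obtain ⟨q, hq1, hq2, hq3, hq4⟩ : ∃ q, q ≤ b i ∧ q ≤ p ∧ Even (b i + q) ∧
      b i + (p - q) ≤ numVariations σ := by
    rw [Nat.even_iff] at hpar
    simp only [Nat.even_iff]
    by_cases h1 : b i ≤ p
    · exact ⟨b i, by omega, by omega, by omega, by omega⟩
    · by_cases h2 : (b i + p) % 2 = 0
      · exact ⟨p, by omega, by omega, by omega, by omega⟩
      · exact ⟨p - 1, by omega, by omega, by omega, by omega⟩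
  -- Target variation counts `0, …, q - 1, b i, b i + 1, …`: strictly increasing since `q ≤ b i`,
  -- and of the parity of `j` since `b i + q` is even.
  set B : ℕ → ℕ := fun j => if j < q then j else b i + (j - q) with hB
  have hBk : ∀ j : Fin (p + 1), B j ≤ numVariations σ := by
    intro j
    have := j.is_le
    simp only [hB]
    split_ifs <;> omega
  have hex : ∀ j : Fin (p + 1), ∃ l, b l = B j ∧ ((j : ℕ) = q → l = i) := by
    intro j
    by_cases hj : (j : ℕ) = q
    · exact ⟨i, by simp [hB, hj], fun _ => rfl⟩
    · obtain ⟨l, hl⟩ := exists_numVariationsBefore_eq σ (hBk j)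
      exact ⟨l, hl, fun h => absurd h hj⟩
  choose e he1 he2 using hex
  refine ⟨e, fun j j' hjj => ?_, ⟨⟨q, by omega⟩, he2 _ rfl⟩, fun j => ?_⟩
  · apply (numVariationsBefore_monotone σ).reflect_lt
    rw [← hb, he1, he1]
    rw [Fin.lt_def] at hjj
    simp only [hB]
    split_ifs <;> omega
  · rw [sign_eq_pow_numVariationsBefore hσ (e j), ← hb, he1]
    congr 1
    apply neg_one_pow_congr
    rw [Nat.even_iff] at hq3
    rw [Nat.even_iff, Nat.even_iff]
    simp only [hB]
    split_ifs <;> omega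

/-- A combination with root multiset `s` whose coefficients have signs given by `σ` or vanish,
the `i`-th one being non-zero. The last condition determines the sign of the function. -/
def HasPartialRealization {n : ℕ} (α : Fin (n + 1) → ℝ) (σ : Fin (n + 1) → SignType)
    (s : Multiset ℝ) (i : Fin (n + 1)) : Prop :=
  ∃ (c : Fin (n + 1) → ℝ) (g : ℝ → ℝ), (∀ j, c j = 0 ∨ SignType.sign (c j) = σ j) ∧ c i ≠ 0 ∧
    AnalyticOnNhd ℝ g (Ioi 0) ∧
    generalizedPolynomial α c = (fun x => rootPolynomial s x * g x) ∧
    ∀ x, 0 < x → SignType.sign (g x) = (-1) ^ s.card * σ 0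

theorem hasPartialRealization_of_pos {n : ℕ} {α : Fin (n + 1) → ℝ} (hα : StrictMono α)
    {σ : Fin (n + 1) → SignType} (hσ : ∀ i, σ i ≠ 0) {s : Multiset ℝ} (hs : ∀ x ∈ s, 0 < x)
    (hp : 0 < s.card) (hpk : s.card ≤ numVariations σ) (hpar : Even (numVariations σ + s.card))
    (i : Fin (n + 1)) : HasPartialRealization α σ s i := by
  obtain ⟨e, he, hi, hσe⟩ := exists_alternating_subsequence hσ hp hpk hpar i
  obtain ⟨c, hc, hroots⟩ := exists_alternating (hα.comp he) hs rfl (hσ 0)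
  obtain ⟨g, hg, hg0, hfg⟩ := hroots.exists_cofactor
  have hc0 : ∀ j, c j ≠ 0 := by
    intro j
    rw [← sign_ne_zero, hc, ← hσe]
    exact hσ _
  refine ⟨Function.extend e c 0, g, fun j => ?_, ?_, hg, ?_, fun x hx => ?_⟩
  · by_cases hj : j ∈ range e
    · obtain ⟨l, rfl⟩ := hj
      right
      rw [he.injective.extend_apply, hc, hσe]
    · left
      rw [Function.extend_apply' _ _ _ hj]; rfl
  · obtain ⟨l, rfl⟩ := hi
    rw [he.injective.extend_apply]
    exact hc0 l
  · rw [← generalizedPolynomial_comp he.injective, Function.extend_comp he.injective, hfg]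
    intro j hj
    rw [Function.extend_apply' _ _ _ hj]; rfl
  -- The last chosen coefficient has sign `(-1) ^ p * σ 0`, and the cofactor shares it.
  · have h1 := sign_pos (pos_mul_cofactor (hα.comp he) hg hg0 hfg (hc0 _) hx)
    rw [sign_mul, hc, Fin.val_last] at h1
    revert h1
    generalize (-1) ^ s.card * σ 0 = u
    generalize SignType.sign (g x) = v
    revert u v
    decide

theorem rpow_le_add_rpow {n : ℕ} {α : Fin (n + 1) → ℝ} (hα : Monotone α) (i : Fin (n + 1)) {x : ℝ}
    (hx : 0 < x) : x ^ α i ≤ x ^ α 0 + x ^ α (Fin.last n) := by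
  have h1 := Real.rpow_pos_of_pos hx (α 0)
  have h2 := Real.rpow_pos_of_pos hx (α (Fin.last n))
  rcases le_total x 1 with h | h
  · linarith [Real.rpow_le_rpow_of_exponent_ge hx h (hα (Fin.zero_le i))]
  · linarith [Real.rpow_le_rpow_of_exponent_le h (hα (Fin.le_last i))]

/-- A monomial suffices if `σ i = σ 0`. Otherwise its term is dominated by the two extreme ones,
whose signs agree because the number of variations is even. -/
theorem hasPartialRealization_zero {n : ℕ} {α : Fin (n + 1) → ℝ} (hα : StrictMono α)
    {σ : Fin (n + 1) → SignType} (hσ : ∀ i, σ i ≠ 0) (hpar : Even (numVariations σ))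
    (i : Fin (n + 1)) : HasPartialRealization α σ 0 i := by
  have hlast : σ (Fin.last n) = σ 0 := by
    rw [sign_eq_pow_numVariationsBefore hσ, numVariationsBefore_last, hpar.neg_one_pow, one_mul]
  obtain ⟨t, ht0, ht⟩ : ∃ t : ℝ, t ≠ 0 ∧ SignType.sign t = σ 0 := by
    have := hσ 0
    generalize σ 0 = u at this
    cases u with
    | zero => exact absurd rfl this
    | pos => exact ⟨1, by norm_num, by simp⟩
    | neg => exact ⟨-1, by norm_num, by simp⟩
  have hpos : ∀ {r : ℝ}, 0 < r → SignType.sign (r * t) = σ 0 := fun hr => by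
    rw [sign_mul, sign_pos hr, one_mul, ht]
  have hi : σ i = σ 0 ∨ σ i = -σ 0 := by
    rw [sign_eq_pow_numVariationsBefore hσ]
    rcases neg_one_pow_eq_or SignType (numVariationsBefore σ i) with h | h <;> simp [h]
  suffices h : ∃ c : Fin (n + 1) → ℝ, (∀ j, c j = 0 ∨ SignType.sign (c j) = σ j) ∧ c i ≠ 0 ∧
      ∀ x, 0 < x → SignType.sign (generalizedPolynomial α c x) = σ 0 by
    obtain ⟨c, h1, h2, h3⟩ := h
    exact ⟨c, generalizedPolynomial α c, h1, h2, analyticOnNhd_generalizedPolynomial _ _,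
      by simp [rootPolynomial], by simpa using h3⟩
  rcases hi with hi | hi
  · refine ⟨fun j => if j = i then t else 0, fun j => ?_, by simpa, fun x hx => ?_⟩
    · by_cases hj : j = i
      · subst hj; simp [ht, hi]
      · simp [hj]
    · have : generalizedPolynomial α (fun j => if j = i then t else 0) x = x ^ α i * t := by
        simp [generalizedPolynomial, mul_comm]
      rw [this, hpos (Real.rpow_pos_of_pos hx _)]
  · have hne : ∀ u : SignType, u ≠ 0 → u ≠ -u := by decide
    have hi0 : i ≠ 0 := by rintro rfl; exact hne _ (hσ 0) hi
    have hil : i ≠ Fin.last n := by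
      rintro rfl; rw [hlast] at hi; exact hne _ (hσ 0) hi
    refine ⟨fun j => (if j = i then -t else 0) + (if j = 0 then 2 * t else 0) +
      (if j = Fin.last n then 2 * t else 0), fun j => ?_, by simp [hi0, hil, ht0], fun x hx => ?_⟩
    · by_cases hj : j = i
      · subst hj; right; simp [hi0, hil, Left.sign_neg, ht, hi]
      · by_cases hj0 : j = 0
        · right
          subst hj0
          simp only [if_neg hj, if_true, zero_add]
          split_ifs
          · rw [← add_mul]; exact hpos (by norm_num)
          · rw [add_zero]; exact hpos (by norm_num)
        · by_cases hjl : j = Fin.last n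
          · right
            simp only [if_neg hj, if_neg hj0, if_pos hjl, zero_add]
            rw [hjl, hlast]
            exact hpos (by norm_num)
          · left
            simp [hj, hj0, hjl]
    · have : generalizedPolynomial α (fun j => (if j = i then -t else 0) +
          (if j = 0 then 2 * t else 0) + (if j = Fin.last n then 2 * t else 0)) x
          = (2 * x ^ α 0 + 2 * x ^ α (Fin.last n) - x ^ α i) * t := by
        simp only [generalizedPolynomial, add_mul, Finset.sum_add_distrib, ite_mul, zero_mul,
          Finset.sum_ite_eq', Finset.mem_univ, if_true]
        ring
      rw [this, hpos]
      linarith [rpow_le_add_rpow hα.monotone i hx, Real.rpow_pos_of_pos hx (α 0),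
        Real.rpow_pos_of_pos hx (α (Fin.last n))]

theorem exists_realization {n : ℕ} {α : Fin (n + 1) → ℝ}
    {σ : Fin (n + 1) → SignType} (hσ : ∀ i, σ i ≠ 0) {s : Multiset ℝ} (hs : ∀ x ∈ s, 0 < x)
    (h : ∀ i, HasPartialRealization α σ s i) :
    ∃ a : Fin (n + 1) → ℝ, (∀ i, SignType.sign (a i) = σ i) ∧
      IsPositiveRootMultiset (generalizedPolynomial α a) s := by
  choose c g hc hc0 hg hfg hsign using h
  refine ⟨fun j => ∑ i, c i j, fun j => sign_sum_eq (fun i _ => hc i j)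
    ⟨j, Finset.mem_univ j, hc0 j⟩, ?_⟩
  have hτ : (-1) ^ s.card * σ 0 ≠ 0 := by
    rcases neg_one_pow_eq_or SignType s.card with h | h <;> simp [h, hσ 0]
  refine isPositiveRootMultiset_of_cofactor (g := fun x => ∑ i, g i x) hs
    (fun x hx => Finset.analyticAt_fun_sum _ fun i _ => hg i x hx) (fun x hx => ?_) ?_
  · rw [← sign_ne_zero, sign_sum_eq (fun i _ => Or.inr (hsign i x hx))
      ⟨0, Finset.mem_univ 0, by rw [← sign_ne_zero, hsign 0 x hx]; exact hτ⟩]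
    exact hτ
  · funext x
    rw [Finset.mul_sum]
    simp only [← fun i => congrFun (hfg i) x]
    unfold generalizedPolynomial
    rw [Finset.sum_comm]
    simp only [Finset.sum_mul]

theorem proposition1 (n : ℕ) (α : Fin (n + 1) → ℝ) (hα : StrictMono α)
    (σ : Fin (n + 1) → SignType) (hσ : ∀ i, σ i ≠ 0)
    (s : Multiset ℝ) (hs : ∀ x ∈ s, 0 < x) :
    (∃ a : Fin (n + 1) → ℝ, (∀ i, SignType.sign (a i) = σ i) ∧
        IsPositiveRootMultiset (generalizedPolynomial α a) s) ↔
      (0 ≤ (numVariations σ : ℤ) - (Multiset.card s : ℤ) ∧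
        Even ((numVariations σ : ℤ) - (Multiset.card s : ℤ))) := by
  -- Parity of the difference becomes parity of a sum of natural numbers.
  rw [Int.even_sub, ← Int.even_add, ← Nat.cast_add, Int.even_coe_nat, sub_nonneg, Nat.cast_le]
  constructor
  · rintro ⟨a, ha, h⟩
    obtain rfl : (fun i => SignType.sign (a i)) = σ := funext ha
    have ha0 : ∀ i, a i ≠ 0 := fun i => sign_ne_zero.1 (hσ i)
    exact ⟨h.vanishesOn.card_le_numVariations hα ha0 hs, h.even_numVariations_add_card hα ha0⟩
  · rintro ⟨hle, hpar⟩
    refine exists_realization hσ hs fun i => ?_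
    rcases Nat.eq_zero_or_pos s.card with h | h
    · obtain rfl := Multiset.card_eq_zero.1 h
      exact hasPartialRealization_zero hα hσ (by simpa using hpar) i
    · exact hasPartialRealization_of_pos hα hσ hs h hle hpar i
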